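/- Let $E$ be a locally compact Hausdorff space with a countable base, equipped with its Borel $\sigma$-algebra. A Feller--Dynkin semigroup on $E$ is a family $(\hat P_t)_{t\ge 0}$ of bounded linear operators on the Banach space $C_0(E)$ of real continuous functions vanishing at infinity (with the sup norm) such that $\hat P_0=\mathrm{id}$, $\hat P_{s+t}=\hat P_s\hat P_t$, $\lim_{t\downarrow 0}\|\hat P_tf-f\|=0$ for every $f\in C_0(E)$, and $0\le f\le 1$ implies $0\le \hat P_tf\le 1$. It is honest if its representing kernels $P_t$, characterised by $\hat P_tf(x)=\int f(y)\,P_t(x,\mathrm dy)$ for $f \in C_0(E)$, are Markov kernels, i.e. $P_t(x,E)=1$ for all $t\ge 0$, $x\in E$. Let $\Omega$ be the space of continuous functions $\omega:[0,\infty)\to E$ with the topology of uniform convergence on compact sets (the compact-open topology) and the $\sigma$-algebra generated by the coordinate maps $X_t(\omega)=\omega(t)$. A diffusion on $E$ is given by an honest Feller--Dynkin semigroup together with probability measures $(\mathbb P^x)_{x\in E}$ on $\Omega$ such that * for all $x\in E$, $n\ge 0$, $0<t_1<\dots<t_n$ and Borel sets $C_0,\dots,C_n\subseteq E$, $$\mathbb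 P^x(X_0\in C_0,X_{t_1}\in C_1,\dots,X_{t_n}\in C_n)=\int_{C_0}\delta_x(\mathrm dx_0)\int_{C_1}P_{t_1}(x_0,\mathrm dx_1)\cdots\int_{C_n}P_{t_n-t_{n-1}}(x_{n-1},\mathrm dx_n);$$ * if $x_n\to x$ in $E$, then $\int f\,\mathrm d\mathbb P^{x_n}\to\int f\,\mathrm d\mathbb P^x$ for every bounded continuous $f:\Omega\to\mathbb R$. Let $\mathcal P$ be the set of lower semi-continuous pseudometrics $m:E\times E\to[0,1]$. For $0<c<1$ and $m\in\mathcal P$ put $U_c(m)(\omega,\omega')=\sup_{t\ge 0}c^t\,m(\omega(t),\omega'(t))$ for $\omega,\omega'\in\Omega$, and $$\mathcal G_c(m)(x,y)=\inf_{\gamma\in\Gamma(\mathbb P^x,\mathbb P^y)}\int U_c(m)\,\mathrm d\gamma ,\qquad x,y\in E,$$ where $\Gamma(\mathbb P^x,\mathbb P^y)$ is the set of probability measures on $\Omega\times\Omega$ with marginals $\mathbb P^x$ and $\mathbb P^y$. **Theorem.** Let a diffusion on $E$, a continuous function $obs:E\to[0,1]$ and $0<c<1$ be given. Define $d^c_0(x,y)=|obs(x)-obs(y)|$,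 $d^c_{n+1}=\mathcal G_c(d^c_n)$ for $n\ge 0$, and $\overline d^c=\sup_{n\in\mathbb N}d^c_n$. Then every $d_n^c$ and $\overline d^c$ belong to $\mathcal P$ (so that $\mathcal G_c$ is applied inside its domain), and $\overline d^c$ is a fixpoint of $\mathcal G_c$: $$\mathcal G_c(\overline d^c)=\overline d^c .$$ -/

import Mathlib

open MeasureTheory ProbabilityTheory Filter Topology
open scoped NNReal ENNReal ZeroAtInfty BoundedContinuousFunction

noncomputable section

namespace DiffusionMetric

/-! ### Feller-Dynkin semigroups and diffusions -/

/-- A Feller-Dynkin semigroup on `E`: a strongly continuous semigroup of bounded linear operators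
on `C₀(E, ℝ)` (with the sup norm) mapping functions with values in `[0,1]` to functions with
values in `[0,1]`. -/
structure FDSemigroup (E : Type*) [TopologicalSpace E] where
  /-- The operator at time `t`. -/
  op : ℝ≥0 → (C₀(E, ℝ) →L[ℝ] C₀(E, ℝ))
  op_zero : op 0 = ContinuousLinearMap.id ℝ C₀(E, ℝ)
  op_add : ∀ s t, op (s + t) = (op s).comp (op t)
  strongly_continuous : ∀ f : C₀(E, ℝ), Tendsto (fun t => ‖op t f - f‖) (𝓝[>] 0) (𝓝 0)
  sub_markov : ∀ (t : ℝ≥0) (f : C₀(E, ℝ)), (∀ x, 0 ≤ f x ∧ f x ≤ 1) →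
    ∀ x, 0 ≤ op t f x ∧ op t f x ≤ 1

/-- The space `Ω` of continuous trajectories `[0,∞) → E`. Its topology is Mathlib's topology on
`C(ℝ≥0, E)`, the compact-open topology. -/
abbrev Trajectory (E : Type*) [TopologicalSpace E] : Type _ := C(ℝ≥0, E)

/-- The `σ`-algebra on `Ω` generated by the coordinate maps `X_s(ω) = ω(s)`, `s ≥ 0`. -/
instance trajectoryMeasurableSpace (E : Type*) [TopologicalSpace E] [MeasurableSpace E] :
    MeasurableSpace (Trajectory E) :=
  ⨆ s : ℝ≥0, MeasurableSpace.comap (fun ω : Trajectory E => ω s) inferInstance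

/-- For `l = [(t₁, C₁), …, (tₙ, Cₙ)]`, the iterated integral
`∫_{C₁} P_{t₁ - s}(x, dx₁) ∫_{C₂} P_{t₂ - t₁}(x₁, dx₂) ⋯ ∫_{Cₙ} P_{tₙ - tₙ₋₁}(xₙ₋₁, dxₙ)`
(used for `s < t₁ < ⋯ < tₙ` only). -/
def cylinderMass {E : Type*} [MeasurableSpace E] (P : ℝ≥0 → Kernel E E) :
    ℝ≥0 → List (ℝ≥0 × Set E) → E → ℝ≥0∞
  | _, [], _ => 1
  | s, (t, C) :: l, x => ∫⁻ y in C, cylinderMass P t l y ∂(P (t - s) x)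

/-- `Q` is the law on trajectories of the Markov process with transition kernels `P` and initial
distribution `μ`: for all `0 < t₁ < ⋯ < tₙ` and all measurable `C₀, C₁, …, Cₙ`,
`Q(X_0 ∈ C₀, X_{t₁} ∈ C₁, …, X_{tₙ} ∈ Cₙ)
  = ∫_{C₀} μ(dx₀) ∫_{C₁} P_{t₁}(x₀, dx₁) ⋯ ∫_{Cₙ} P_{tₙ - tₙ₋₁}(xₙ₋₁, dxₙ)`. -/
def IsPathLaw {E : Type*} [TopologicalSpace E] [MeasurableSpace E] (P : ℝ≥0 → Kernel E E)
    (μ : Measure E) (Q : Measure (Trajectory E)) : Prop :=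
  ∀ (C₀ : Set E) (l : List (ℝ≥0 × Set E)), MeasurableSet C₀ → (∀ p ∈ l, MeasurableSet p.2) →
    List.Pairwise (· < ·) (0 :: l.map Prod.fst) →
    Q {ω | ω 0 ∈ C₀ ∧ ∀ p ∈ l, ω p.1 ∈ p.2} = ∫⁻ x in C₀, cylinderMass P 0 l x ∂μ

/-- A diffusion on `E`: an honest Feller-Dynkin process with continuous trajectories, whose laws
`ℙ^x` on the trajectory space depend weakly continuously on the starting point `x`. -/
structure Diffusion (E : Type*) [TopologicalSpace E] [MeasurableSpace E]
    extends FDSemigroup E where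
  /-- The family of kernels `P_t` representing the semigroup. -/
  kernel : ℝ≥0 → Kernel E E
  op_eq_integral : ∀ (t : ℝ≥0) (f : C₀(E, ℝ)) (x : E), op t f x = ∫ y, f y ∂(kernel t x)
  /-- The semigroup is honest: `P_t(x, E) = 1`. -/
  honest : ∀ t, IsMarkovKernel (kernel t)
  /-- The law `ℙ^x` of the process started at `x`. -/
  law : E → Measure (Trajectory E)
  law_isProbabilityMeasure : ∀ x, IsProbabilityMeasure (law x)
  law_isPathLaw : ∀ x, IsPathLaw kernel (Measure.dirac x) (law x)
  law_weakly_continuous : ∀ (u : ℕ → E) (x : E), Tendsto u atTop (𝓝 x) →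
    ∀ f : Trajectory E →ᵇ ℝ,
      Tendsto (fun n => ∫ ω, f ω ∂(law (u n))) atTop (𝓝 (∫ ω, f ω ∂(law x)))

/-! ### Pseudometrics, couplings, optimal transport -/

/-- `m` belongs to the lattice `𝒫` of lower semi-continuous `1`-bounded pseudometrics on `E`. -/
structure IsLSCPseudometric {E : Type*} [TopologicalSpace E] (m : E → E → ℝ) : Prop where
  self : ∀ x, m x x = 0
  nonneg : ∀ x y, 0 ≤ m x y
  symm : ∀ x y, m x y = m y x
  triangle : ∀ x y z, m x z ≤ m x y + m y z
  le_one : ∀ x y, m x y ≤ 1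
  lowerSemicontinuous : LowerSemicontinuous (fun p : E × E => m p.1 p.2)

/-- The set `Γ(μ, ν)` of couplings: probability measures on the product with marginals `μ`, `ν`. -/
def couplings {X Y : Type*} [MeasurableSpace X] [MeasurableSpace Y]
    (μ : Measure X) (ν : Measure Y) : Set (Measure (X × Y)) :=
  {γ | IsProbabilityMeasure γ ∧ γ.map Prod.fst = μ ∧ γ.map Prod.snd = ν}

/-- The optimal transport cost `W(k)(μ, ν) = inf_{γ ∈ Γ(μ, ν)} ∫ k dγ` for a nonnegative bounded
cost function `k`. -/
def transportCost {X : Type*} [MeasurableSpace X] (k : X → X → ℝ) (μ ν : Measure X) : ℝ :=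
  (⨅ γ ∈ couplings μ ν, ∫⁻ p, ENNReal.ofReal (k p.1 p.2) ∂γ).toReal

/-- The discounted uniform pseudometric
`U_c(m)(ω, ω') = sup_{t ≥ 0} c^t m(ω(t), ω'(t))` on trajectories. -/
def discountedUniform {E : Type*} [TopologicalSpace E] (c : ℝ) (m : E → E → ℝ)
    (ω ω' : Trajectory E) : ℝ :=
  ⨆ t : ℝ≥0, c ^ (t : ℝ) * m (ω t) (ω' t)

/-- The functional `𝒢_c(m)(x, y) = W(U_c(m))(ℙ^x, ℙ^y)`. -/
def Diffusion.G {E : Type*} [TopologicalSpace E] [MeasurableSpace E] (D : Diffusion E) (c : ℝ)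
    (m : E → E → ℝ) (x y : E) : ℝ :=
  transportCost (discountedUniform c m) (D.law x) (D.law y)

/-- The sequence `d_0(x, y) = |obs x - obs y|`, `d_{n+1} = 𝒢_c(d_n)`. -/
def Diffusion.d {E : Type*} [TopologicalSpace E] [MeasurableSpace E] (D : Diffusion E)
    (obs : E → ℝ) (c : ℝ) : ℕ → E → E → ℝ
  | 0 => fun x y => |obs x - obs y|
  | n + 1 => D.G c (D.d obs c n)

/-- The pseudometric `d̄^c = sup_n d_n`. -/
def Diffusion.dBar {E : Type*} [TopologicalSpace E] [MeasurableSpace E] (D : Diffusion E)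
    (obs : E → ℝ) (c : ℝ) (x y : E) : ℝ :=
  ⨆ n : ℕ, D.d obs c n x y

end DiffusionMetric

end

open MeasureTheory ProbabilityTheory Filter Topology
open scoped NNReal ENNReal BoundedContinuousFunction

namespace DiffusionMetric

/-! ### The trajectory space is a Polish space with its Borel `σ`-algebra -/

/-! At time 0 every coupling of `ℙ^x` and `ℙ^y` sits at `(x, y)`, so `m ≤ 𝒢_c(m)` (`le_G`). Hence
`d_n` increases and `d̄ ≤ 𝒢_c(d̄)`.

The converse is a compactness argument, `transportCost_le_of_tendsto`. Near-optimal couplings `γ_n`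
for the costs `U_c(d_n)` have tight marginals, so a subsequence converges weakly to a coupling `γ`.
For fixed `j`, lower semicontinuity gives `∫ U_c(d_j) dγ ≤ liminf ∫ U_c(d_j) dγ_n`, and eventually
`U_c(d_j) ≤ U_c(d_n)`, so the bound on the costs passes to the limit. Monotone convergence in `j`
then bounds the cost of `U_c(d̄)`, because `U_c` commutes with suprema.

Since the marginals may vary too, the same lemma, with a constant sequence of costs and moving
starting points, shows that `𝒢_c(m)` is lower semicontinuous. The triangle inequality for `𝒢_c(m)`
comes from gluing couplings. Prokhorov's theorem and disintegration require `Ω` to be Polish with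
the coordinate `σ`-algebra as its Borel `σ`-algebra. -/

/-- A locally compact space densely embedded in a Hausdorff space is open in it. -/
theorem isOpen_range_of_isDenseEmbedding {X Y : Type*} [TopologicalSpace X] [TopologicalSpace Y]
    [LocallyCompactSpace X] [T2Space Y] {i : X → Y} (hi : IsDenseEmbedding i) :
    IsOpen (Set.range i) := by
  rw [isOpen_iff_mem_nhds]
  rintro _ ⟨x, rfl⟩
  obtain ⟨K, hK, hxK⟩ := exists_compact_mem_nhds x
  obtain ⟨V, hV, hVK⟩ := hi.isInducing.isOpen_iff.1 (isOpen_interior (s := K))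
  have hxV : i x ∈ V := by
    have : x ∈ i ⁻¹' V := hVK ▸ mem_interior_iff_mem_nhds.2 hxK
    exact this
  refine mem_of_superset (hV.mem_nhds hxV) ?_
  have hsub : V ∩ Set.range i ⊆ i '' K := by
    rintro _ ⟨hy, z, rfl⟩
    have : z ∈ interior K := hVK ▸ hy
    exact ⟨z, interior_subset this, rfl⟩
  have hclosed : IsClosed (i '' K) := (hK.image hi.continuous).isClosed
  exact ((hi.dense.open_subset_closure_inter hV).trans
    (hclosed.closure_subset_iff.2 hsub)).trans (Set.image_subset_range i K)

/-- For any compatible metric, `E` is dense, hence open, in its completion, and open subsets of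
Polish spaces are Polish. -/
theorem polishSpace_of_locallyCompact (E : Type*) [TopologicalSpace E] [LocallyCompactSpace E]
    [T2Space E] [SecondCountableTopology E] : PolishSpace E := by
  let : MetricSpace E := TopologicalSpace.metrizableSpaceMetric E
  have hi : IsDenseEmbedding ((↑) : E → UniformSpace.Completion E) :=
    UniformSpace.Completion.isDenseEmbedding_coe
  have : SecondCountableTopology (UniformSpace.Completion E) :=
    UniformSpace.secondCountable_of_separable _
  have : PolishSpace (Set.range ((↑) : E → UniformSpace.Completion E)) :=
    (isOpen_range_of_isDenseEmbedding hi).polishSpace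
  exact (hi.isEmbedding.toHomeomorph).isClosedEmbedding.polishSpace

theorem polishSpace_trajectory (E : Type*) [TopologicalSpace E] [PolishSpace E] :
    PolishSpace (Trajectory E) := by
  let := TopologicalSpace.upgradeIsCompletelyMetrizable E
  infer_instance

/-- Lusin–Souslin. The source `σ`-algebra is written `borel X` because `Trajectory E` already
carries the coordinate `σ`-algebra as its instance. -/
theorem measurableSet_image_of_injective {X Y : Type*} [TopologicalSpace X] [PolishSpace X]
    [TopologicalSpace Y] [PolishSpace Y] [MeasurableSpace Y] [BorelSpace Y] {f : X → Y}
    (hf : Continuous f) (hinj : Function.Injective f) {s : Set X} (hs : MeasurableSet[borel X] s) :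
    MeasurableSet (f '' s) := by
  borelize X
  exact hs.image_of_continuousOn_injOn hf.continuousOn hinj.injOn

/-- Evaluation along a dense sequence of times embeds `Ω` continuously and injectively into the
Polish space `ℕ → E`. A Borel set is the preimage of its image, which is Borel by Lusin–Souslin, and
this evaluation map is measurable for the coordinate `σ`-algebra. -/
theorem borelSpace_trajectory (E : Type*) [TopologicalSpace E] [PolishSpace E]
    [MeasurableSpace E] [BorelSpace E] : BorelSpace (Trajectory E) := by
  have := polishSpace_trajectory E
  refine ⟨le_antisymm ?_ ?_⟩
  · refine iSup_le fun s => ?_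
    rw [← measurable_iff_comap_le]
    borelize (Trajectory E)
    exact (continuous_eval_const s).measurable
  · let D := TopologicalSpace.denseSeq ℝ≥0
    let Φ : Trajectory E → ℕ → E := fun ω n => ω (D n)
    have hinj : Function.Injective Φ := fun ω ω' h => by
      ext t
      exact congrFun (Continuous.ext_on (TopologicalSpace.denseRange_denseSeq ℝ≥0)
        ω.continuous ω'.continuous (by rintro _ ⟨n, rfl⟩; exact congrFun h n)) t
    have hmeas : @Measurable _ _ (trajectoryMeasurableSpace E) _ Φ :=
      measurable_pi_lambda _ fun n => measurable_iff_comap_le.2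
        (le_iSup (fun s : ℝ≥0 => MeasurableSpace.comap (fun ω : Trajectory E => ω s) _) (D n))
    intro s hs
    have := hmeas (measurableSet_image_of_injective
      (continuous_pi fun n => continuous_eval_const (D n)) hinj hs)
    rwa [hinj.preimage_image] at this

/-! ### Compactness of couplings and lower semicontinuity of integrals -/

/-- A convergent sequence together with its limit is compact, so the converse half of Prokhorov's
theorem applies. -/
theorem isTightMeasureSet_range_of_tendsto {X : Type*} [TopologicalSpace X] [PolishSpace X]
    [MeasurableSpace X] [BorelSpace X] {μs : ℕ → ProbabilityMeasure X} {μ : ProbabilityMeasure X}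
    (h : Tendsto μs atTop (𝓝 μ)) :
    IsTightMeasureSet (Set.range fun n => (μs n : Measure X)) := by
  let := TopologicalSpace.upgradeIsCompletelyMetrizable X
  have hc : IsCompact (closure (Set.range μs)) :=
    h.isCompact_insert_range.closure_of_subset (Set.subset_insert _ _)
  refine (isTightMeasureSet_of_isCompact_closure hc).subset ?_
  rintro _ ⟨n, rfl⟩
  exact ⟨μs n, ⟨n, rfl⟩, rfl⟩

theorem isTightMeasureSet_range_of_couplings {X : Type*} [TopologicalSpace X] [T2Space X]
    [MeasurableSpace X] [BorelSpace X] {μs νs : ℕ → Measure X} {γs : ℕ → Measure (X × X)}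
    (hμ : IsTightMeasureSet (Set.range μs)) (hν : IsTightMeasureSet (Set.range νs))
    (hγ : ∀ n, γs n ∈ couplings (μs n) (νs n)) :
    IsTightMeasureSet (Set.range γs) := by
  rw [isTightMeasureSet_iff_exists_isCompact_measure_compl_le] at hμ hν ⊢
  intro ε hε
  obtain ⟨K, hK, hμK⟩ := hμ (ε / 2) (ENNReal.half_pos hε.ne')
  obtain ⟨L, hL, hνL⟩ := hν (ε / 2) (ENNReal.half_pos hε.ne')
  refine ⟨K ×ˢ L, hK.prod hL, ?_⟩
  rintro _ ⟨n, rfl⟩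
  have h1 : γs n (Prod.fst ⁻¹' Kᶜ) ≤ ε / 2 := by
    rw [← Measure.map_apply measurable_fst hK.measurableSet.compl, (hγ n).2.1]
    exact hμK _ ⟨n, rfl⟩
  have h2 : γs n (Prod.snd ⁻¹' Lᶜ) ≤ ε / 2 := by
    rw [← Measure.map_apply measurable_snd hL.measurableSet.compl, (hγ n).2.2]
    exact hνL _ ⟨n, rfl⟩
  calc γs n (K ×ˢ L)ᶜ ≤ γs n (Prod.fst ⁻¹' Kᶜ ∪ Prod.snd ⁻¹' Lᶜ) := by
        refine measure_mono fun p hp => ?_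
        simp only [Set.mem_compl_iff, Set.mem_prod, not_and_or] at hp
        exact hp
    _ ≤ γs n (Prod.fst ⁻¹' Kᶜ) + γs n (Prod.snd ⁻¹' Lᶜ) := measure_union_le _ _
    _ ≤ ε / 2 + ε / 2 := add_le_add h1 h2
    _ = ε := ENNReal.add_halves ε

/-- Couplings of weakly convergent sequences subconverge to a coupling of the limits. -/
theorem exists_subseq_tendsto_coupling {X : Type*} [TopologicalSpace X] [PolishSpace X]
    [MeasurableSpace X] [BorelSpace X] {μs νs : ℕ → ProbabilityMeasure X}
    {μ ν : ProbabilityMeasure X} (hμ : Tendsto μs atTop (𝓝 μ)) (hν : Tendsto νs atTop (𝓝 ν))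
    {γs : ℕ → ProbabilityMeasure (X × X)}
    (hγ : ∀ n, (γs n : Measure (X × X)) ∈ couplings (μs n : Measure X) (νs n : Measure X)) :
    ∃ γ : ProbabilityMeasure (X × X), (γ : Measure (X × X)) ∈ couplings (μ : Measure X) ν ∧
      ∃ φ : ℕ → ℕ, StrictMono φ ∧ Tendsto (γs ∘ φ) atTop (𝓝 γ) := by
  have ht := isTightMeasureSet_range_of_couplings (isTightMeasureSet_range_of_tendsto hμ)
    (isTightMeasureSet_range_of_tendsto hν) hγ
  have hc : IsCompact (closure (Set.range γs)) := by
    refine isCompact_closure_of_isTightMeasureSet (ht.subset ?_)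
    rintro _ ⟨_, ⟨n, rfl⟩, rfl⟩
    exact ⟨n, rfl⟩
  let := TopologicalSpace.upgradeIsCompletelyMetrizable X
  obtain ⟨γ, -, φ, hφ, hlim⟩ := hc.isSeqCompact fun n => subset_closure (Set.mem_range_self n)
  refine ⟨γ, ⟨inferInstance, ?_, ?_⟩, φ, hφ, hlim⟩
  · have h1 := ProbabilityMeasure.tendsto_map_of_tendsto_of_continuous _ _ hlim continuous_fst
    have h2 : Tendsto (fun n => ((γs ∘ φ) n).map (continuous_fst.measurable.aemeasurable))
        atTop (𝓝 μ) := by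
      convert hμ.comp hφ.tendsto_atTop using 2 with n
      exact Subtype.ext (hγ (φ n)).2.1
    have h3 := tendsto_nhds_unique h1 h2
    exact congrArg Subtype.val h3
  · have h1 := ProbabilityMeasure.tendsto_map_of_tendsto_of_continuous _ _ hlim continuous_snd
    have h2 : Tendsto (fun n => ((γs ∘ φ) n).map (continuous_snd.measurable.aemeasurable))
        atTop (𝓝 ν) := by
      convert hν.comp hφ.tendsto_atTop using 2 with n
      exact Subtype.ext (hγ (φ n)).2.2
    have h3 := tendsto_nhds_unique h1 h2
    exact congrArg Subtype.val h3

/-- Layer-cake formula, the portmanteau inequality on the open superlevel sets, then Fatou in the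
level. -/
theorem lintegral_le_liminf_of_lowerSemicontinuous {Y : Type*} [TopologicalSpace Y]
    [HasOuterApproxClosed Y] [MeasurableSpace Y] [BorelSpace Y]
    {γs : ℕ → ProbabilityMeasure Y} {γ : ProbabilityMeasure Y} (hγ : Tendsto γs atTop (𝓝 γ))
    {f : Y → ℝ} (hf : LowerSemicontinuous f) (hf0 : 0 ≤ f) :
    ∫⁻ y, ENNReal.ofReal (f y) ∂(γ : Measure Y) ≤
      liminf (fun n => ∫⁻ y, ENNReal.ofReal (f y) ∂(γs n : Measure Y)) atTop := by
  simp_rw [lintegral_eq_lintegral_meas_lt _ (Eventually.of_forall hf0) hf.measurable.aemeasurable]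
  calc ∫⁻ t in Set.Ioi (0 : ℝ), (γ : Measure Y) {a | t < f a}
      ≤ ∫⁻ t in Set.Ioi (0 : ℝ), liminf (fun n => (γs n : Measure Y) {a | t < f a}) atTop :=
        lintegral_mono fun t =>
          ProbabilityMeasure.le_liminf_measure_open_of_tendsto hγ (hf.isOpen_preimage t)
    _ ≤ _ := lintegral_liminf_le fun n => Antitone.measurable fun s t hst =>
        measure_mono fun y hy => lt_of_le_of_lt hst hy

/-! ### Optimal transport for a bounded lower semicontinuous pseudometric cost -/

theorem prod_mem_couplings {X Y : Type*} [MeasurableSpace X] [MeasurableSpace Y] (μ : Measure X)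
    (ν : Measure Y) [IsProbabilityMeasure μ] [IsProbabilityMeasure ν] :
    μ.prod ν ∈ couplings μ ν :=
  ⟨inferInstance, by simp, by simp⟩

theorem diag_mem_couplings {X : Type*} [MeasurableSpace X] (μ : Measure X)
    [IsProbabilityMeasure μ] : μ.map (fun x => (x, x)) ∈ couplings μ μ := by
  have hd : Measurable fun x : X => (x, x) := measurable_id.prodMk measurable_id
  refine ⟨Measure.isProbabilityMeasure_map hd.aemeasurable, ?_, ?_⟩
  · rw [Measure.map_map measurable_fst hd]; exact Measure.map_id
  · rw [Measure.map_map measurable_snd hd]; exact Measure.map_id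

theorem swap_mem_couplings {X Y : Type*} [MeasurableSpace X] [MeasurableSpace Y] {μ : Measure X}
    {ν : Measure Y} {γ : Measure (X × Y)} (hγ : γ ∈ couplings μ ν) :
    γ.map Prod.swap ∈ couplings ν μ := by
  have := hγ.1
  refine ⟨Measure.isProbabilityMeasure_map measurable_swap.aemeasurable, ?_, ?_⟩
  · rw [Measure.map_map measurable_fst measurable_swap]; exact hγ.2.2
  · rw [Measure.map_map measurable_snd measurable_swap]; exact hγ.2.1

/-- The gluing lemma: two couplings with a common marginal are marginals of one measure. -/
theorem exists_gluing {X Y Z : Type*} [MeasurableSpace X] [MeasurableSpace Y] [MeasurableSpace Z]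
    [StandardBorelSpace Z] {μ : Measure X} {ν : Measure Y} {ρ : Measure Z}
    {γ : Measure (X × Y)} {η : Measure (Y × Z)} (hγ : γ ∈ couplings μ ν)
    (hη : η ∈ couplings ν ρ) :
    ∃ θ : Measure ((X × Y) × Z), IsProbabilityMeasure θ ∧ θ.map Prod.fst = γ ∧
      θ.map (fun p => (p.1.2, p.2)) = η := by
  have := hγ.1
  have := hη.1
  have : Nonempty Z := (nonempty_of_isProbabilityMeasure η).map Prod.snd
  have hm : Measurable fun p : (X × Y) × Z => (p.1.2, p.2) := by fun_prop
  -- Given `(x, y)` drawn from `γ`, draw `z` from the conditional law of `η` given `y`.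
  refine ⟨γ ⊗ₘ (η.condKernel.comap Prod.snd measurable_snd), inferInstance,
    Measure.fst_compProd _ _, ?_⟩
  ext s hs
  have hηs : η s = ∫⁻ y, η.condKernel y (Prod.mk y ⁻¹' s) ∂ν := by
    conv_lhs => rw [← η.disintegrate η.condKernel]
    rw [Measure.compProd_apply hs, Measure.fst, hη.2.1]
  rw [Measure.map_apply hm hs, Measure.compProd_apply (hm hs), hηs, ← hγ.2.2,
    lintegral_map (Kernel.measurable_kernel_prodMk_left hs) measurable_snd]
  rfl

section TransportCost

variable {X : Type*} [MeasurableSpace X] {k : X → X → ℝ} {μ ν : Measure X}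

theorem iInf_couplings_le_one (hk : ∀ x y, k x y ≤ 1) (μ ν : Measure X)
    [IsProbabilityMeasure μ] [IsProbabilityMeasure ν] :
    ⨅ γ ∈ couplings μ ν, ∫⁻ p, ENNReal.ofReal (k p.1 p.2) ∂γ ≤ 1 := by
  refine (iInf₂_le _ (prod_mem_couplings μ ν)).trans ?_
  calc ∫⁻ p, ENNReal.ofReal (k p.1 p.2) ∂(μ.prod ν) ≤ ∫⁻ _, 1 ∂(μ.prod ν) :=
        lintegral_mono fun p => by simpa using hk p.1 p.2
    _ = 1 := by simp

/-- The infimum is finite, so `toReal` loses nothing and estimates can be made in `ℝ≥0∞`. -/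
theorem ofReal_transportCost (hk : ∀ x y, k x y ≤ 1) (μ ν : Measure X)
    [IsProbabilityMeasure μ] [IsProbabilityMeasure ν] :
    ENNReal.ofReal (transportCost k μ ν) =
      ⨅ γ ∈ couplings μ ν, ∫⁻ p, ENNReal.ofReal (k p.1 p.2) ∂γ :=
  ENNReal.ofReal_toReal ((iInf_couplings_le_one hk μ ν).trans_lt ENNReal.one_lt_top).ne

theorem transportCost_nonneg : 0 ≤ transportCost k μ ν := ENNReal.toReal_nonneg

theorem transportCost_le_one (hk : ∀ x y, k x y ≤ 1) (μ ν : Measure X)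
    [IsProbabilityMeasure μ] [IsProbabilityMeasure ν] : transportCost k μ ν ≤ 1 := by
  exact (ENNReal.toReal_mono ENNReal.one_ne_top (iInf_couplings_le_one hk μ ν)).trans_eq ENNReal.toReal_one

theorem exists_coupling_lintegral_lt (hk : ∀ x y, k x y ≤ 1) [IsProbabilityMeasure μ]
    [IsProbabilityMeasure ν] {a : ℝ≥0∞} (h : ENNReal.ofReal (transportCost k μ ν) < a) :
    ∃ γ ∈ couplings μ ν, ∫⁻ p, ENNReal.ofReal (k p.1 p.2) ∂γ < a := by
  rw [ofReal_transportCost hk] at h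
  simpa only [iInf_lt_iff, exists_prop] using h

theorem ofReal_transportCost_le (hk : ∀ x y, k x y ≤ 1) [IsProbabilityMeasure μ]
    [IsProbabilityMeasure ν] {γ : Measure (X × X)} (hγ : γ ∈ couplings μ ν) :
    ENNReal.ofReal (transportCost k μ ν) ≤ ∫⁻ p, ENNReal.ofReal (k p.1 p.2) ∂γ := by
  rw [ofReal_transportCost hk]
  exact iInf₂_le _ hγ

theorem transportCost_comm (hm : Measurable fun p : X × X => k p.1 p.2)
    (hk : ∀ x y, k x y = k y x) (μ ν : Measure X) :
    transportCost k μ ν = transportCost k ν μ := by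
  have key : ∀ μ ν : Measure X, (⨅ γ ∈ couplings ν μ, ∫⁻ p, ENNReal.ofReal (k p.1 p.2) ∂γ) ≤
      ⨅ γ ∈ couplings μ ν, ∫⁻ p, ENNReal.ofReal (k p.1 p.2) ∂γ := fun μ ν => by
    refine le_iInf₂ fun γ hγ => (iInf₂_le _ (swap_mem_couplings hγ)).trans_eq ?_
    rw [lintegral_map hm.ennreal_ofReal measurable_swap]
    exact lintegral_congr fun p => by rw [Prod.fst_swap, Prod.snd_swap, hk]
  exact congrArg ENNReal.toReal (le_antisymm (key ν μ) (key μ ν))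

theorem transportCost_self (hm : Measurable fun p : X × X => k p.1 p.2)
    (hk1 : ∀ x y, k x y ≤ 1) (hk : ∀ x, k x x = 0) (μ : Measure X) [IsProbabilityMeasure μ] :
    transportCost k μ μ = 0 := by
  refine le_antisymm (ENNReal.ofReal_eq_zero.1 (le_antisymm ?_ zero_le)) transportCost_nonneg
  refine (ofReal_transportCost_le hk1 (diag_mem_couplings μ)).trans_eq ?_
  rw [lintegral_map hm.ennreal_ofReal (by fun_prop)]
  simp [hk]

theorem transportCost_triangle [StandardBorelSpace X]
    (hm : Measurable fun p : X × X => k p.1 p.2)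
    (hk0 : ∀ x y, 0 ≤ k x y) (hk1 : ∀ x y, k x y ≤ 1) (hk : ∀ x y z, k x z ≤ k x y + k y z)
    (μ ν ρ : Measure X)
    [IsProbabilityMeasure μ] [IsProbabilityMeasure ν] [IsProbabilityMeasure ρ] :
    transportCost k μ ρ ≤ transportCost k μ ν + transportCost k ν ρ := by
  rw [← ENNReal.ofReal_le_ofReal_iff (add_nonneg transportCost_nonneg transportCost_nonneg),
    ENNReal.ofReal_add transportCost_nonneg transportCost_nonneg,
    ofReal_transportCost hk1 μ ν, ofReal_transportCost hk1 ν ρ]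
  simp only [ENNReal.iInf_add, ENNReal.add_iInf]
  refine le_iInf₂ fun η hη => le_iInf₂ fun γ hγ => ?_
  obtain ⟨θ, hθ, hθγ, hθη⟩ := exists_gluing hγ hη
  have hm1 : Measurable fun p : (X × X) × X => (p.1.1, p.2) := by fun_prop
  have hm2 : Measurable fun p : (X × X) × X => (p.1.2, p.2) := by fun_prop
  have hc : θ.map (fun p => (p.1.1, p.2)) ∈ couplings μ ρ := by
    refine ⟨Measure.isProbabilityMeasure_map hm1.aemeasurable, ?_, ?_⟩
    · rw [Measure.map_map measurable_fst hm1, ← hγ.2.1, ← hθγ,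
        Measure.map_map measurable_fst measurable_fst]
      rfl
    · rw [Measure.map_map measurable_snd hm1, ← hη.2.2, ← hθη,
        Measure.map_map measurable_snd hm2]
      rfl
  refine (ofReal_transportCost_le hk1 hc).trans ?_
  rw [lintegral_map hm.ennreal_ofReal hm1, ← hθη, lintegral_map hm.ennreal_ofReal hm2, ← hθγ,
    lintegral_map hm.ennreal_ofReal measurable_fst, ← lintegral_add_left]
  · exact lintegral_mono fun p => by
      rw [← ENNReal.ofReal_add (hk0 _ _) (hk0 _ _)]
      exact ENNReal.ofReal_le_ofReal (hk _ _ _)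
  · exact (hm.comp measurable_fst).ennreal_ofReal

/-- Lower semicontinuity of the transport cost, jointly in the marginals and along increasing
sequences of lower semicontinuous costs. -/
theorem transportCost_le_of_tendsto [TopologicalSpace X] [PolishSpace X] [BorelSpace X]
    {ks : ℕ → X → X → ℝ} (hlsc : ∀ n, LowerSemicontinuous fun p : X × X => ks n p.1 p.2)
    (hks0 : ∀ n x y, 0 ≤ ks n x y) (hks1 : ∀ n x y, ks n x y ≤ 1)
    (hmono : ∀ x y, Monotone fun n => ks n x y) (hk1 : ∀ x y, k x y ≤ 1)
    (hk : ∀ x y, k x y ≤ ⨆ n, ks n x y)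
    {μs νs : ℕ → ProbabilityMeasure X} {μ ν : ProbabilityMeasure X}
    (hμ : Tendsto μs atTop (𝓝 μ)) (hν : Tendsto νs atTop (𝓝 ν)) {a : ℝ}
    (h : ∀ n, transportCost (ks n) (μs n : Measure X) (νs n : Measure X) ≤ a) :
    transportCost k (μ : Measure X) (ν : Measure X) ≤ a := by
  -- The slack `1 / (n + 1)` avoids having to know that optimal couplings exist.
  have ha : 0 ≤ a := transportCost_nonneg.trans (h 0)
  have hex : ∀ n, ∃ γ : ProbabilityMeasure (X × X),
      (γ : Measure (X × X)) ∈ couplings (μs n : Measure X) (νs n : Measure X) ∧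
      ∫⁻ p, ENNReal.ofReal (ks n p.1 p.2) ∂(γ : Measure (X × X)) ≤
        ENNReal.ofReal (a + 1 / ((n : ℝ) + 1)) := fun n => by
    have hpos : (0 : ℝ) < 1 / ((n : ℝ) + 1) := Nat.one_div_pos_of_nat
    obtain ⟨γ, hγ, hlt⟩ := exists_coupling_lintegral_lt (hks1 n)
      ((ENNReal.ofReal_lt_ofReal_iff (by linarith)).2
        (show transportCost (ks n) (μs n : Measure X) (νs n : Measure X) <
          a + 1 / ((n : ℝ) + 1) by linarith [h n]))
    exact ⟨⟨γ, hγ.1⟩, hγ, hlt.le⟩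
  choose γs hγs hcost using hex
  obtain ⟨γ, hγ, φ, hφ, hlim⟩ := exists_subseq_tendsto_coupling hμ hν hγs
  have htend : Tendsto (fun n => ENNReal.ofReal (a + 1 / ((φ n : ℝ) + 1))) atTop
      (𝓝 (ENNReal.ofReal a)) := by
    refine ENNReal.tendsto_ofReal ?_
    simpa using (tendsto_one_div_add_atTop_nhds_zero_nat (𝕜 := ℝ)).comp hφ.tendsto_atTop
      |>.const_add a
  have hj : ∀ j, ∫⁻ p, ENNReal.ofReal (ks j p.1 p.2) ∂(γ : Measure (X × X)) ≤
      ENNReal.ofReal a := fun j => by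
    let := TopologicalSpace.upgradeIsCompletelyMetrizable X
    refine (lintegral_le_liminf_of_lowerSemicontinuous hlim (hlsc j)
      fun p => hks0 j _ _).trans ?_
    rw [← htend.liminf_eq]
    refine liminf_le_liminf ?_
    filter_upwards [eventually_ge_atTop j] with n hn
    -- Here `j ≤ n ≤ φ n`, so the cost `ks j` is dominated by `ks (φ n)`.
    refine le_trans (lintegral_mono fun p => ENNReal.ofReal_le_ofReal ?_) (hcost (φ n))
    exact hmono _ _ (hn.trans hφ.le_apply)
  rw [← ENNReal.ofReal_le_ofReal_iff ha]
  refine (ofReal_transportCost_le hk1 hγ).trans ?_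
  calc ∫⁻ p, ENNReal.ofReal (k p.1 p.2) ∂(γ : Measure (X × X))
      ≤ ∫⁻ p, ⨆ n, ENNReal.ofReal (ks n p.1 p.2) ∂(γ : Measure (X × X)) := by
        refine lintegral_mono fun p => ENNReal.ofReal_le_of_le_toReal ?_
        have hb : ⨆ n, ENNReal.ofReal (ks n p.1 p.2) ≠ ∞ :=
          ((iSup_le fun n => by simpa using hks1 n p.1 p.2 :
            ⨆ n, ENNReal.ofReal (ks n p.1 p.2) ≤ 1).trans_lt ENNReal.one_lt_top).ne
        refine (hk _ _).trans (ciSup_le fun n => ?_)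
        rw [← ENNReal.ofReal_le_iff_le_toReal hb]
        exact le_iSup (fun n => ENNReal.ofReal (ks n p.1 p.2)) n
    _ = ⨆ n, ∫⁻ p, ENNReal.ofReal (ks n p.1 p.2) ∂(γ : Measure (X × X)) :=
        lintegral_iSup (fun n => (hlsc n).measurable.ennreal_ofReal)
          fun i j hij p => ENNReal.ofReal_le_ofReal (hmono _ _ hij)
    _ ≤ ENNReal.ofReal a := iSup_le hj

end TransportCost

/-! ### The discounted uniform pseudometric -/

section DiscountedUniform

variable {E : Type*} [TopologicalSpace E] {c : ℝ} {m m' : E → E → ℝ}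

theorem discount_mul_le_one (hc0 : 0 < c) (hc1 : c < 1) (hm : IsLSCPseudometric m)
    (t : ℝ≥0) (x y : E) : c ^ (t : ℝ) * m x y ≤ 1 :=
  mul_le_one₀ (Real.rpow_le_one hc0.le hc1.le t.2) (hm.nonneg _ _) (hm.le_one _ _)

theorem bddAbove_discount (hc0 : 0 < c) (hc1 : c < 1) (hm : IsLSCPseudometric m)
    (ω ω' : Trajectory E) :
    BddAbove (Set.range fun t : ℝ≥0 => c ^ (t : ℝ) * m (ω t) (ω' t)) :=
  ⟨1, by rintro _ ⟨t, rfl⟩; exact discount_mul_le_one hc0 hc1 hm t _ _⟩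

theorem discount_mul_le_discountedUniform (hc0 : 0 < c) (hc1 : c < 1) (hm : IsLSCPseudometric m)
    (ω ω' : Trajectory E) (t : ℝ≥0) :
    c ^ (t : ℝ) * m (ω t) (ω' t) ≤ discountedUniform c m ω ω' :=
  le_ciSup (bddAbove_discount hc0 hc1 hm ω ω') t

theorem le_discountedUniform (hc0 : 0 < c) (hc1 : c < 1) (hm : IsLSCPseudometric m)
    (ω ω' : Trajectory E) : m (ω 0) (ω' 0) ≤ discountedUniform c m ω ω' := by
  simpa using discount_mul_le_discountedUniform hc0 hc1 hm ω ω' 0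

theorem discountedUniform_mono (hc0 : 0 < c) (hc1 : c < 1) (hm' : IsLSCPseudometric m')
    (h : ∀ x y, m x y ≤ m' x y) (ω ω' : Trajectory E) :
    discountedUniform c m ω ω' ≤ discountedUniform c m' ω ω' :=
  ciSup_mono (bddAbove_discount hc0 hc1 hm' ω ω') fun _ =>
    mul_le_mul_of_nonneg_left (h _ _) (Real.rpow_nonneg hc0.le _)

theorem IsLSCPseudometric.discountedUniform (hc0 : 0 < c) (hc1 : c < 1)
    (hm : IsLSCPseudometric m) : IsLSCPseudometric (discountedUniform c m) where
  self ω := by simp [DiffusionMetric.discountedUniform, hm.self]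
  nonneg ω ω' := (hm.nonneg _ _).trans (le_discountedUniform hc0 hc1 hm ω ω')
  symm ω ω' := by simp only [DiffusionMetric.discountedUniform, hm.symm]
  triangle ω₁ ω₂ ω₃ := ciSup_le fun t => by
    have h0 : (0 : ℝ) ≤ c ^ (t : ℝ) := Real.rpow_nonneg hc0.le _
    calc c ^ (t : ℝ) * m (ω₁ t) (ω₃ t)
        ≤ c ^ (t : ℝ) * m (ω₁ t) (ω₂ t) + c ^ (t : ℝ) * m (ω₂ t) (ω₃ t) := by
          rw [← mul_add]
          exact mul_le_mul_of_nonneg_left (hm.triangle _ _ _) h0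
      _ ≤ _ := add_le_add (discount_mul_le_discountedUniform hc0 hc1 hm _ _ t)
          (discount_mul_le_discountedUniform hc0 hc1 hm _ _ t)
  le_one ω ω' := ciSup_le fun t => discount_mul_le_one hc0 hc1 hm t _ _
  lowerSemicontinuous := by
    refine lowerSemicontinuous_ciSup (fun p => bddAbove_discount hc0 hc1 hm p.1 p.2) fun t => ?_
    have heval : Continuous fun p : Trajectory E × Trajectory E => (p.1 t, p.2 t) := by fun_prop
    have hmono : Monotone fun r : ℝ => c ^ (t : ℝ) * r := fun _ _ h =>
      mul_le_mul_of_nonneg_left h (Real.rpow_nonneg hc0.le _)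
    exact (continuous_const_mul (c ^ (t : ℝ))).comp_lowerSemicontinuous
      (hm.lowerSemicontinuous.comp heval) hmono

/-- Two suprema are exchanged; only this inequality is needed for the limit argument. -/
theorem discountedUniform_iSup_le (hc0 : 0 < c) (hc1 : c < 1) {ms : ℕ → E → E → ℝ}
    (hms : ∀ n, IsLSCPseudometric (ms n)) (ω ω' : Trajectory E) :
    discountedUniform c (fun x y => ⨆ n, ms n x y) ω ω' ≤
      ⨆ n, discountedUniform c (ms n) ω ω' := by
  refine ciSup_le fun t => ?_
  rw [Real.mul_iSup_of_nonneg (Real.rpow_nonneg hc0.le _)]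
  refine ciSup_mono ⟨1, ?_⟩ fun n =>
    discount_mul_le_discountedUniform hc0 hc1 (hms n) ω ω' t
  rintro _ ⟨n, rfl⟩
  exact ((hms n).discountedUniform hc0 hc1).le_one _ _

end DiscountedUniform

theorem IsLSCPseudometric.bddAbove_range {E : Type*} [TopologicalSpace E] {ms : ℕ → E → E → ℝ}
    (hms : ∀ n, IsLSCPseudometric (ms n)) (x y : E) :
    BddAbove (Set.range fun n => ms n x y) :=
  ⟨1, by rintro _ ⟨n, rfl⟩; exact (hms n).le_one x y⟩

theorem IsLSCPseudometric.iSup {E : Type*} [TopologicalSpace E] {ms : ℕ → E → E → ℝ}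
    (hms : ∀ n, IsLSCPseudometric (ms n)) : IsLSCPseudometric fun x y => ⨆ n, ms n x y where
  self x := by simp [(hms _).self]
  nonneg x y := Real.iSup_nonneg fun n => (hms n).nonneg x y
  symm x y := by simp only [(hms _).symm x y]
  triangle x y z := ciSup_le fun n => ((hms n).triangle x y z).trans
    (add_le_add (le_ciSup (bddAbove_range hms x y) n) (le_ciSup (bddAbove_range hms y z) n))
  le_one x y := ciSup_le fun n => (hms n).le_one x y
  lowerSemicontinuous := lowerSemicontinuous_ciSup (fun p => bddAbove_range hms p.1 p.2)
    fun n => (hms n).lowerSemicontinuous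

theorem isLSCPseudometric_abs_sub {E : Type*} [TopologicalSpace E] {f : E → ℝ} (hf : Continuous f)
    (hf01 : ∀ x, f x ∈ Set.Icc (0 : ℝ) 1) : IsLSCPseudometric fun x y => |f x - f y| where
  self x := by simp
  nonneg x y := abs_nonneg _
  symm x y := abs_sub_comm _ _
  triangle x y z := abs_sub_le _ _ _
  le_one x y := abs_sub_le_iff.2
    ⟨by linarith [(hf01 x).2, (hf01 y).1], by linarith [(hf01 y).2, (hf01 x).1]⟩
  lowerSemicontinuous := by
    have : Continuous fun p : E × E => |f p.1 - f p.2| := by fun_prop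
    exact this.lowerSemicontinuous

/-! ### The functional `𝒢_c` -/

namespace Diffusion

variable {E : Type*} [TopologicalSpace E] [MeasurableSpace E] (D : Diffusion E)

/-- The law `ℙ^x` as a bundled probability measure. -/
noncomputable def probLaw (x : E) : ProbabilityMeasure (Trajectory E) :=
  ⟨D.law x, D.law_isProbabilityMeasure x⟩

theorem tendsto_probLaw [OpensMeasurableSpace (Trajectory E)] {u : ℕ → E} {x : E}
    (hu : Tendsto u atTop (𝓝 x)) :
    Tendsto (fun n => D.probLaw (u n)) atTop (𝓝 (D.probLaw x)) :=
  ProbabilityMeasure.tendsto_iff_forall_integral_tendsto.2 (D.law_weakly_continuous u x hu)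

theorem ae_law_start [MeasurableSingletonClass E] (x : E) : ∀ᵐ ω ∂(D.law x), ω 0 = x := by
  have := D.law_isProbabilityMeasure x
  -- With no positive times, the cylinder formula describes the law of `ω 0` alone.
  have h := D.law_isPathLaw x {x} [] (measurableSet_singleton x) (by simp) (by simp)
  have hmeas : Measurable fun ω : Trajectory E => ω 0 := measurable_iff_comap_le.2
    (le_iSup (fun s : ℝ≥0 => MeasurableSpace.comap (fun ω : Trajectory E => ω s) _) 0)
  have h1 : D.law x {ω | ω 0 = x} = 1 := by
    simpa [cylinderMass] using h
  exact (prob_compl_eq_zero_iff (hmeas (measurableSet_singleton x))).2 h1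

variable {c : ℝ} {m : E → E → ℝ}

theorem le_G [MeasurableSingletonClass E] (hc0 : 0 < c) (hc1 : c < 1) (hm : IsLSCPseudometric m)
    (x y : E) : m x y ≤ D.G c m x y := by
  have := D.law_isProbabilityMeasure x
  have := D.law_isProbabilityMeasure y
  rw [G, ← ENNReal.ofReal_le_ofReal_iff transportCost_nonneg,
    ofReal_transportCost (hm.discountedUniform hc0 hc1).le_one]
  refine le_iInf₂ fun γ hγ => ?_
  have := hγ.1
  have hx : ∀ᵐ p ∂γ, p.1 0 = x := by
    refine ae_of_ae_map measurable_fst.aemeasurable (p := fun ω : Trajectory E => ω 0 = x) ?_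
    rw [hγ.2.1]
    exact D.ae_law_start x
  have hy : ∀ᵐ p ∂γ, p.2 0 = y := by
    refine ae_of_ae_map measurable_snd.aemeasurable (p := fun ω : Trajectory E => ω 0 = y) ?_
    rw [hγ.2.2]
    exact D.ae_law_start y
  calc ENNReal.ofReal (m x y) = ∫⁻ _, ENNReal.ofReal (m x y) ∂γ := by simp
    _ ≤ ∫⁻ p, ENNReal.ofReal (discountedUniform c m p.1 p.2) ∂γ := by
      refine lintegral_mono_ae ?_
      filter_upwards [hx, hy] with p hpx hpy
      refine ENNReal.ofReal_le_ofReal ?_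
      have := le_discountedUniform hc0 hc1 hm p.1 p.2
      rwa [hpx, hpy] at this

variable [LocallyCompactSpace E] [T2Space E] [SecondCountableTopology E] [BorelSpace E]

/-- `𝒢_c` is lower semicontinuous along increasing sequences of pseudometrics and convergent
sequences of points. -/
theorem G_iSup_le_of_tendsto (hc0 : 0 < c) (hc1 : c < 1) {ms : ℕ → E → E → ℝ}
    (hms : ∀ n, IsLSCPseudometric (ms n)) (hmono : ∀ x y, Monotone fun n => ms n x y)
    {u v : ℕ → E} {x y : E} (hu : Tendsto u atTop (𝓝 x)) (hv : Tendsto v atTop (𝓝 y)) {a : ℝ}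
    (h : ∀ n, D.G c (ms n) (u n) (v n) ≤ a) :
    D.G c (fun x y => ⨆ n, ms n x y) x y ≤ a := by
  have := polishSpace_of_locallyCompact E
  have := polishSpace_trajectory E
  have := borelSpace_trajectory E
  have hU n := (hms n).discountedUniform hc0 hc1
  exact transportCost_le_of_tendsto (fun n => (hU n).lowerSemicontinuous)
    (fun n => (hU n).nonneg) (fun n => (hU n).le_one)
    (fun ω ω' i j hij =>
      discountedUniform_mono hc0 hc1 (hms j) (fun x y => hmono x y hij) ω ω')
    ((IsLSCPseudometric.iSup hms).discountedUniform hc0 hc1).le_one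
    (discountedUniform_iSup_le hc0 hc1 hms) (D.tendsto_probLaw hu) (D.tendsto_probLaw hv) h

theorem isLSCPseudometric_G (hc0 : 0 < c) (hc1 : c < 1) (hm : IsLSCPseudometric m) :
    IsLSCPseudometric (D.G c m) := by
  have := polishSpace_of_locallyCompact E
  have := polishSpace_trajectory E
  have := borelSpace_trajectory E
  have := D.law_isProbabilityMeasure
  have hU := hm.discountedUniform hc0 hc1
  have hUm := hU.lowerSemicontinuous.measurable
  refine ⟨fun x => transportCost_self hUm hU.le_one hU.self _, fun x y => transportCost_nonneg,
    fun x y => transportCost_comm hUm hU.symm _ _,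
    fun x y z => transportCost_triangle hUm hU.nonneg hU.le_one hU.triangle _ _ _,
    fun x y => transportCost_le_one hU.le_one _ _, ?_⟩
  rintro ⟨x, y⟩ a ha
  -- `E × E` is first countable, so a failure of lower semicontinuity is witnessed by a sequence
  -- along which `𝒢_c(m) ≤ a`.
  by_contra hcon
  obtain ⟨u, hu, hua⟩ := exists_seq_forall_of_frequently (not_eventually.1 hcon)
  rw [nhds_prod_eq] at hu
  have key := D.G_iSup_le_of_tendsto hc0 hc1 (ms := fun _ => m) (fun _ => hm)
    (fun _ _ => monotone_const) hu.fst hu.snd (fun n => not_lt.1 (hua n))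
  simp only [ciSup_const] at key
  exact absurd ha (not_lt.2 key)

variable {obs : E → ℝ}

theorem isLSCPseudometric_d (hobs : Continuous obs) (hobs01 : ∀ x, obs x ∈ Set.Icc (0 : ℝ) 1)
    (hc0 : 0 < c) (hc1 : c < 1) (n : ℕ) : IsLSCPseudometric (D.d obs c n) := by
  induction n with
  | zero => exact isLSCPseudometric_abs_sub hobs hobs01
  | succ n ih => exact D.isLSCPseudometric_G hc0 hc1 ih

theorem monotone_d (hobs : Continuous obs) (hobs01 : ∀ x, obs x ∈ Set.Icc (0 : ℝ) 1)
    (hc0 : 0 < c) (hc1 : c < 1) (x y : E) : Monotone fun n => D.d obs c n x y :=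
  monotone_nat_of_le_succ fun n =>
    D.le_G hc0 hc1 (D.isLSCPseudometric_d hobs hobs01 hc0 hc1 n) x y

end Diffusion

end DiffusionMetric

theorem mainTheorem1 {E : Type*} [TopologicalSpace E] [LocallyCompactSpace E] [T2Space E]
    [SecondCountableTopology E] [MeasurableSpace E] [BorelSpace E]
    (D : DiffusionMetric.Diffusion E)
    (obs : E → ℝ) (hobs : Continuous obs) (hobs01 : ∀ x, obs x ∈ Set.Icc (0 : ℝ) 1)
    (c : ℝ) (hc0 : 0 < c) (hc1 : c < 1) :
    (∀ n, DiffusionMetric.IsLSCPseudometric (D.d obs c n)) ∧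
      DiffusionMetric.IsLSCPseudometric (D.dBar obs c) ∧
      D.G c (D.dBar obs c) = D.dBar obs c := by
  have hd := D.isLSCPseudometric_d hobs hobs01 hc0 hc1
  have hBar : DiffusionMetric.IsLSCPseudometric (D.dBar obs c) :=
    DiffusionMetric.IsLSCPseudometric.iSup hd
  refine ⟨hd, hBar, ?_⟩
  funext x y
  refine le_antisymm ?_ (D.le_G hc0 hc1 hBar x y)
  -- The starting points stay fixed and `a = d̄(x, y)`; the hypothesis holds since `𝒢_c(d_n) =
  -- d_{n+1} ≤ d̄`.
  exact D.G_iSup_le_of_tendsto hc0 hc1 hd (D.monotone_d hobs hobs01 hc0 hc1)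
    tendsto_const_nhds tendsto_const_nhds fun n =>
      le_ciSup (DiffusionMetric.IsLSCPseudometric.bddAbove_range hd x y) (n + 1)
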